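/- Let $d\in\mathbb{N}$, let $M\ge 1$ be an integer, put $\mathcal X=\mathbb{R}^d$ (with its Borel sets) and $\mathcal Y=\{1,\dots,M\}$, and let $(X,Y)$ be a random pair with an arbitrary law $\mu=\mu_{X,Y}$ on $\mathcal X\times\mathcal Y$. For a random variable $U$ with values in a standard Borel space, let $I(U;Y)=H(Y)-H(Y|U)$, where $H(Y)=-\sum_{y}\mathbb P(Y=y)\log \mathbb P(Y=y)$ and $H(Y|U)$ is the integral, over the law of $U$, of the Shannon entropy of the conditional law of $Y$ given $U=u$. For a measurable encoder $\eta:\mathcal X\to\mathbb{R}$ let $I(X;Y|\eta(X))=\int \mathcal I(\mu_{X,Y|\eta(X)=u})\,d\mu_{\eta(X)}(u)$ be the conditional mutual information, where $\mathcal I(\nu)$ is the mutual information of a pair with law $\nu$; let $H(\eta(X))\in[0,\infty]$ be the Shannon entropy of $\eta(X)$, equal to $\infty$ if $\eta(X)$ is not discrete. For $B>0$, a solution $\eta^B$ of the deterministic information bottleneck problem is a measurable $\eta:\mathcal X\to\mathbb{R}$ with $H(\eta(X))\le B$ that maximizes $I(\eta(X);Y)$ among all measurable encoders $\mathcal X\to\mathbb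 R$ with $H(\eta(X))\le B$. Then for every model $\mu_{X,Y}$ and every $\epsilon>0$ there is $B(\epsilon,\mu_{X,Y})>0$ such that for every $B\ge B(\epsilon,\mu_{X,Y})$ and every solution $\eta^B$ of the problem with restriction $B$, $$I(X;Y|\eta^B(X))<\epsilon .$$ In particular, if $\eta^B$ is a solution for each $B>0$, then $\lim_{B\to\infty} I(X;Y|\eta^B(X))=0$. -/

import Mathlib

open MeasureTheory ProbabilityTheory Filter Topology
open scoped ENNReal

/-- Shannon entropy (in nats) of a probability `ν` on the finite alphabet `Fin M`:
`- ∑ y, ν {y} * log (ν {y})`, with `0 * log 0 = 0`. -/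
noncomputable def labelEntropy {M : ℕ} (ν : Measure (Fin M)) : ℝ :=
  ∑ y : Fin M, Real.negMulLog (ν.real {y})

open Classical in
/-- Shannon entropy (in nats) of a probability `ν` on the real line, with values in `[0, ∞]`:
`- ∑ u, ν {u} * log (ν {u})` if `ν` is discrete (carried by a countable set),
and `∞` otherwise. -/
noncomputable def shannonEntropy (ν : Measure ℝ) : ℝ≥0∞ :=
  if ∃ S : Set ℝ, S.Countable ∧ ν Sᶜ = 0 then
    ∑' u : ℝ, ENNReal.ofReal (Real.negMulLog (ν.real {u}))
  else ∞

/-- Conditional entropy `H(Y|Z)` of a joint law `ρ` of `(Z, Y)`: the integral over `z`, with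
respect to the law of `Z`, of the entropy of the conditional law of `Y` given `Z = z`. -/
noncomputable def condEntropy {𝒵 : Type*} [MeasurableSpace 𝒵] {M : ℕ} [NeZero M]
    (ρ : Measure (𝒵 × Fin M)) [IsFiniteMeasure ρ] : ℝ :=
  ∫ z, labelEntropy (ρ.condKernel z) ∂ρ.fst

/-- Mutual information `I(Z;Y) = H(Y) - H(Y|Z)` of a joint law `ρ` of `(Z, Y)`. -/
noncomputable def mutualInfo {𝒵 : Type*} [MeasurableSpace 𝒵] {M : ℕ} [NeZero M]
    (ρ : Measure (𝒵 × Fin M)) [IsFiniteMeasure ρ] : ℝ :=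
  labelEntropy ρ.snd - condEntropy ρ

/-- `I(η(X);Y)` when `(X, Y)` has law `μ`: the mutual information of the law of `(η(X), Y)`. -/
noncomputable def encodedInfo {𝒳 : Type*} [MeasurableSpace 𝒳] {M : ℕ} [NeZero M]
    (μ : Measure (𝒳 × Fin M)) [IsFiniteMeasure μ] (η : 𝒳 → ℝ) : ℝ :=
  mutualInfo (μ.map (fun p => (η p.1, p.2)))

/-- The conditional law of `(X, Y)` given `η(X) = u`, as a Markov kernel in `u`,
when `(X, Y)` has law `μ`. -/
noncomputable def condJoint {𝒳 : Type*} [MeasurableSpace 𝒳] [StandardBorelSpace 𝒳] [Nonempty 𝒳]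
    {M : ℕ} [NeZero M] (μ : Measure (𝒳 × Fin M)) [IsFiniteMeasure μ] (η : 𝒳 → ℝ) :
    Kernel ℝ (𝒳 × Fin M) :=
  condDistrib (fun p => p) (fun p => η p.1) μ

instance condJoint_isMarkovKernel {𝒳 : Type*} [MeasurableSpace 𝒳] [StandardBorelSpace 𝒳] [Nonempty 𝒳]
    {M : ℕ} [NeZero M] (μ : Measure (𝒳 × Fin M)) [IsFiniteMeasure μ] (η : 𝒳 → ℝ) :
    IsMarkovKernel (condJoint μ η) := by
  unfold condJoint; infer_instance

/-- Conditional mutual information `I(X;Y|η(X))` when `(X, Y)` has law `μ`: the integral over `u`,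
with respect to the law of `η(X)`, of the mutual information of the conditional law of `(X, Y)`
given `η(X) = u`. -/
noncomputable def condMutualInfo {𝒳 : Type*} [MeasurableSpace 𝒳] [StandardBorelSpace 𝒳]
    [Nonempty 𝒳] {M : ℕ} [NeZero M] (μ : Measure (𝒳 × Fin M)) [IsFiniteMeasure μ]
    (η : 𝒳 → ℝ) : ℝ :=
  ∫ u, mutualInfo (condJoint μ η u) ∂(μ.map (fun p => η p.1))

/-- `η` solves the deterministic information bottleneck problem with restriction `B` for `μ`: it is
a measurable encoder with `H(η(X)) ≤ B`, and it maximizes `I(η'(X);Y)` among all measurable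
encoders `η'` with `H(η'(X)) ≤ B`. -/
structure IsIBSolution {𝒳 : Type*} [MeasurableSpace 𝒳] {M : ℕ} [NeZero M]
    (μ : Measure (𝒳 × Fin M)) [IsFiniteMeasure μ] (B : ℝ) (η : 𝒳 → ℝ) : Prop where
  measurable : Measurable η
  entropy_le : shannonEntropy (μ.fst.map η) ≤ ENNReal.ofReal B
  isMax : ∀ η' : 𝒳 → ℝ, Measurable η' → shannonEntropy (μ.fst.map η') ≤ ENNReal.ofReal B →
    encodedInfo μ η' ≤ encodedInfo μ η

theorem labelEntropy_mem_Icc {M : ℕ} (ν : Measure (Fin M)) [IsProbabilityMeasure ν] :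
    labelEntropy ν ∈ Set.Icc (0 : ℝ) M := by
  have h : ∀ y : Fin M, 0 ≤ Real.negMulLog (ν.real {y}) ∧ Real.negMulLog (ν.real {y}) ≤ 1 := by
    intro y
    have h0 : 0 ≤ ν.real {y} := measureReal_nonneg
    have h1 : ν.real {y} ≤ 1 := measureReal_le_one
    refine ⟨Real.negMulLog_nonneg h0 h1, ?_⟩
    have := Real.negMulLog_le_one_sub_self h0
    linarith
  refine ⟨Finset.sum_nonneg fun y _ => (h y).1, ?_⟩
  calc labelEntropy ν ≤ ∑ _y : Fin M, (1 : ℝ) := Finset.sum_le_sum fun y _ => (h y).2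
    _ = M := by simp

theorem measurable_labelEntropy {α : Type*} [MeasurableSpace α] {M : ℕ}
    (κ : Kernel α (Fin M)) : Measurable fun a => labelEntropy (κ a) := by
  unfold labelEntropy
  refine Finset.measurable_sum _ fun y _ => ?_
  exact Real.continuous_negMulLog.measurable.comp
    (κ.measurable_coe (MeasurableSet.singleton y)).ennreal_toReal

/-- The integrand in the definition of `condMutualInfo` is integrable, so that the integral has its
usual meaning. -/
theorem integrable_mutualInfo_condJoint {𝒳 : Type*} [MeasurableSpace 𝒳] [StandardBorelSpace 𝒳]
    [Nonempty 𝒳] {M : ℕ} [NeZero M] (μ : Measure (𝒳 × Fin M)) [IsFiniteMeasure μ] (η : 𝒳 → ℝ) :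
    Integrable (fun u => mutualInfo (condJoint μ η u)) (μ.map (fun p => η p.1)) := by
  set κ := condJoint μ η with hκ
  have hc : ∀ u, condEntropy (κ u) = ∫ x, labelEntropy (κ.condKernel (u, x)) ∂(κ.fst u) := by
    intro u
    unfold condEntropy
    rw [Kernel.fst_apply, Measure.fst]
    refine integral_congr_ae ?_
    have := Kernel.condKernel_apply_eq_condKernel κ u
    rw [Kernel.fst_apply] at this
    filter_upwards [this] with x hx
    rw [← hx]
  have hm : Measurable fun u => condEntropy (κ u) := by
    simp_rw [hc]
    have h := (measurable_labelEntropy κ.condKernel).stronglyMeasurable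
    exact (h.integral_kernel_prod_right (κ := κ.fst)
      (f := fun u x => labelEntropy (κ.condKernel (u, x)))).measurable
  have hb : ∀ u, condEntropy (κ u) ∈ Set.Icc (0 : ℝ) M := by
    intro u
    unfold condEntropy
    have hl : ∀ x, labelEntropy ((κ u).condKernel x) ∈ Set.Icc (0 : ℝ) M :=
      fun x => labelEntropy_mem_Icc _
    refine ⟨integral_nonneg fun x => (hl x).1, ?_⟩
    have hi : Integrable (fun x => labelEntropy ((κ u).condKernel x)) (κ u).fst :=
      Integrable.of_bound (measurable_labelEntropy _).aestronglyMeasurable M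
        (ae_of_all _ fun x => by rw [Real.norm_eq_abs, abs_of_nonneg (hl x).1]; exact (hl x).2)
    calc ∫ x, labelEntropy ((κ u).condKernel x) ∂(κ u).fst
        ≤ ∫ _x, (M : ℝ) ∂(κ u).fst := integral_mono hi (integrable_const _) fun x => (hl x).2
      _ = M := by simp
  have hs : Measurable fun u => labelEntropy (κ u).snd := by
    have h := measurable_labelEntropy κ.snd
    simp only [Kernel.snd_apply] at h
    exact h
  have hms : ∀ u, labelEntropy (κ u).snd ∈ Set.Icc (0 : ℝ) M := fun u => labelEntropy_mem_Icc _
  refine Integrable.of_bound (hs.sub hm).aestronglyMeasurable M (ae_of_all _ fun u => ?_)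
  have h1 := hms u
  have h2 := hb u
  change ‖labelEntropy (κ u).snd - condEntropy (κ u)‖ ≤ M
  rw [Real.norm_eq_abs, abs_le]
  exact ⟨by linarith [h1.1, h2.2], by linarith [h1.2, h2.1]⟩

/-! Since η(X) is a function of X, the chain rule gives I(X;Y|η(X)) = H(Y|η(X)) - H(Y|X)
(`condMutualInfo_eq_sub`), so maximizing I(η(X);Y) is the same as minimizing I(X;Y|η(X)). It
therefore suffices to exhibit one encoder of finite entropy whose loss is below ε: once B exceeds
its entropy it is a competitor, and every solution loses no more than it does. Such an encoder comes
from rounding the posterior vector P(Y=y|X) to a finite grid (`exists_finite_range_condEntropy_lt`).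
It recovers each posterior up to a small error, and `Real.negMulLog` is uniformly continuous on
[0,1]. -/

/-! ### Conditional entropy and nonnegativity of mutual information. -/

theorem integrable_labelEntropy {α : Type*} [MeasurableSpace α] {M : ℕ} (ν : Measure α)
    [IsFiniteMeasure ν] (κ : Kernel α (Fin M)) [IsMarkovKernel κ] :
    Integrable (fun a => labelEntropy (κ a)) ν := by
  refine Integrable.of_bound (measurable_labelEntropy κ).aestronglyMeasurable M
    (ae_of_all _ fun a => ?_)
  have h := labelEntropy_mem_Icc (κ a)
  rw [Real.norm_eq_abs, abs_of_nonneg h.1]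
  exact h.2

/-- Conditional entropy can be computed from any disintegration of the joint law. -/
theorem condEntropy_eq_of_eq_compProd {𝒵 : Type*} [MeasurableSpace 𝒵] {M : ℕ} [NeZero M]
    (ρ : Measure (𝒵 × Fin M)) [IsFiniteMeasure ρ] (κ : Kernel 𝒵 (Fin M)) [IsFiniteKernel κ]
    (h : ρ = ρ.fst ⊗ₘ κ) : condEntropy ρ = ∫ z, labelEntropy (κ z) ∂ρ.fst := by
  unfold condEntropy
  refine integral_congr_ae ?_
  filter_upwards [eq_condKernel_of_measure_eq_compProd κ h] with z hz
  rw [hz]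

/-- Jensen's inequality for the concave function `Real.negMulLog`, label by label. It yields the
lower bound 0 needed for the limit statement. -/
theorem condEntropy_le_labelEntropy_snd {𝒵 : Type*} [MeasurableSpace 𝒵] {M : ℕ} [NeZero M]
    (ρ : Measure (𝒵 × Fin M)) [IsProbabilityMeasure ρ] :
    condEntropy ρ ≤ labelEntropy ρ.snd := by
  have hmem : ∀ y z, (ρ.condKernel z).real {y} ∈ Set.Icc (0 : ℝ) 1 :=
    fun y z => ⟨measureReal_nonneg, measureReal_le_one⟩
  have hmeas : ∀ y, Measurable fun z => (ρ.condKernel z).real {y} := fun y =>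
    (ρ.condKernel.measurable_coe (MeasurableSet.singleton y)).ennreal_toReal
  have hint : ∀ y, Integrable (fun z => (ρ.condKernel z).real {y}) ρ.fst := fun y =>
    Integrable.of_bound (hmeas y).aestronglyMeasurable 1 (ae_of_all _ fun z => by
      rw [Real.norm_eq_abs, abs_of_nonneg (hmem y z).1]; exact (hmem y z).2)
  have hint' : ∀ y, Integrable (fun z => Real.negMulLog ((ρ.condKernel z).real {y})) ρ.fst :=
    fun y => Integrable.of_bound
      (Real.continuous_negMulLog.measurable.comp (hmeas y)).aestronglyMeasurable 1
      (ae_of_all _ fun z => by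
        rw [Real.norm_eq_abs, abs_of_nonneg (Real.negMulLog_nonneg (hmem y z).1 (hmem y z).2)]
        linarith [Real.negMulLog_le_one_sub_self (hmem y z).1, (hmem y z).1])
  unfold condEntropy labelEntropy
  rw [integral_finsetSum _ fun y _ => hint' y]
  refine Finset.sum_le_sum fun y _ => ?_
  -- The posterior probabilities of y average to its marginal probability.
  have hsnd : ∫ z, (ρ.condKernel z).real {y} ∂ρ.fst = ρ.snd.real {y} := by
    rw [measureReal_def, Measure.snd_apply (MeasurableSet.singleton y)]
    conv_rhs => rw [← ρ.disintegrate ρ.condKernel]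
    rw [Measure.compProd_apply (measurable_snd (MeasurableSet.singleton y)),
      ← integral_toReal (f := fun z => ρ.condKernel z (Prod.mk z ⁻¹' (Prod.snd ⁻¹' {y})))
        (ρ.condKernel.measurable_coe (MeasurableSet.singleton y)).aemeasurable
        (ae_of_all _ fun z => measure_lt_top _ _)]
    rfl
  rw [← hsnd]
  exact Real.concaveOn_negMulLog.le_map_integral Real.continuous_negMulLog.continuousOn
    isClosed_Ici (ae_of_all _ fun z => (hmem y z).1) (hint y) (hint' y)

theorem condMutualInfo_nonneg {𝒳 : Type*} [MeasurableSpace 𝒳] [StandardBorelSpace 𝒳]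
    [Nonempty 𝒳] {M : ℕ} [NeZero M] (μ : Measure (𝒳 × Fin M)) [IsFiniteMeasure μ]
    (η : 𝒳 → ℝ) : 0 ≤ condMutualInfo μ η :=
  integral_nonneg fun u => sub_nonneg.2 (condEntropy_le_labelEntropy_snd (condJoint μ η u))

/-! ### Chain rule for an encoder that is a function of X. -/

section ChainRule

variable {𝒳 : Type*} [MeasurableSpace 𝒳] [StandardBorelSpace 𝒳] [Nonempty 𝒳] {M : ℕ} [NeZero M]
  (μ : Measure (𝒳 × Fin M)) [IsFiniteMeasure μ] {η : 𝒳 → ℝ}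

theorem compProd_condJoint :
    μ.map (fun p => η p.1) ⊗ₘ condJoint μ η = μ.map (fun p => (η p.1, p)) :=
  compProd_map_condDistrib aemeasurable_id

theorem compProd_condJoint_fst (hη : Measurable η) :
    μ.map (fun p => η p.1) ⊗ₘ (condJoint μ η).fst = μ.map (fun p => (η p.1, p.1)) := by
  rw [Kernel.fst_eq, Measure.compProd_map measurable_fst, compProd_condJoint,
    Measure.map_map (by fun_prop) (by fun_prop)]
  rfl

theorem compProd_condJoint_snd (hη : Measurable η) :
    μ.map (fun p => η p.1) ⊗ₘ (condJoint μ η).snd = μ.map (fun p => (η p.1, p.2)) := by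
  rw [Kernel.snd_eq, Measure.compProd_map measurable_snd, compProd_condJoint,
    Measure.map_map (by fun_prop) (by fun_prop)]
  rfl

/-- Conditioning on `η(X)` does not change the conditional law of `Y` given `X`. -/
theorem condJoint_ae_eq (hη : Measurable η) :
    condJoint μ η =ᵐ[μ.map (fun p => η p.1)]
      (condJoint μ η).fst ⊗ₖ Kernel.prodMkLeft ℝ μ.condKernel := by
  -- By a.e. uniqueness of conditional laws, it is enough that the right-hand kernel, composed with
  -- the law of η(X), gives the law of (η(X), (X, Y)); this is tested on nonnegative measurable
  -- functions.
  refine condDistrib_ae_eq_of_measure_eq_compProd _ aemeasurable_id ?_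
  refine Measure.ext_of_lintegral _ fun f hf => ?_
  have hg : Measurable fun q : ℝ × 𝒳 => ∫⁻ y, f (q.1, q.2, y) ∂μ.condKernel q.2 := by
    exact Measurable.lintegral_kernel_prod_right (κ := Kernel.prodMkLeft ℝ μ.condKernel)
      (f := fun (q : ℝ × 𝒳) y => f (q.1, q.2, y)) (by fun_prop)
  have h1 : ∫⁻ a, f a ∂(μ.map (fun p => η p.1) ⊗ₘ
      ((condJoint μ η).fst ⊗ₖ Kernel.prodMkLeft ℝ μ.condKernel)) =
      ∫⁻ q, ∫⁻ y, f (q.1, q.2, y) ∂μ.condKernel q.2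
        ∂(μ.map (fun p => η p.1) ⊗ₘ (condJoint μ η).fst) := by
    rw [Measure.lintegral_compProd hf, Measure.lintegral_compProd hg]
    refine lintegral_congr fun u => ?_
    rw [Kernel.lintegral_compProd _ _ _ (by fun_prop)]
    rfl
  rw [h1, compProd_condJoint_fst μ hη, lintegral_map hg (by fun_prop),
    lintegral_map hf (by fun_prop)]
  have h2 : ∫⁻ p, ∫⁻ y, f (η p.1, p.1, y) ∂μ.condKernel p.1 ∂μ =
      ∫⁻ x, ∫⁻ y, f (η x, x, y) ∂μ.condKernel x ∂μ.fst := by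
    rw [Measure.fst, lintegral_map (f := fun x => ∫⁻ y, f (η x, x, y) ∂μ.condKernel x)
      (hg.comp (hη.prodMk measurable_id)) measurable_fst]
  refine Eq.trans ?_ h2.symm
  rw [Measure.lintegral_condKernel (ρ := μ) (f := fun p => f (η p.1, p.1, p.2)) (by fun_prop)]
  rfl

/-- Chain rule: `I(X;Y|η(X)) = H(Y|η(X)) - H(Y|X)`. -/
theorem condMutualInfo_eq_sub (hη : Measurable η) :
    condMutualInfo μ η =
      condEntropy (μ.map (fun p => (η p.1, p.2))) - condEntropy μ := by
  set κ := condJoint μ η with hκ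
  set ν := μ.map (fun p => η p.1) with hν
  have hfst : (μ.map (fun p : 𝒳 × Fin M => (η p.1, p.2))).fst = ν :=
    Measure.fst_map_prodMk measurable_snd
  have hY : condEntropy (μ.map (fun p => (η p.1, p.2))) = ∫ u, labelEntropy (κ.snd u) ∂ν := by
    rw [condEntropy_eq_of_eq_compProd _ κ.snd, hfst]
    rw [hfst, compProd_condJoint_snd μ hη]
  have hcond : ∀ᵐ u ∂ν, condEntropy (κ u) = ∫ x, labelEntropy (μ.condKernel x) ∂κ.fst u := by
    filter_upwards [condJoint_ae_eq μ hη] with u hu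
    have : (κ u) = (κ u).fst ⊗ₘ μ.condKernel := by
      refine hu.trans ?_
      rw [Kernel.compProd_apply_eq_compProd_sectR, ← hκ, Kernel.fst_apply]
      rfl
    rw [condEntropy_eq_of_eq_compProd _ _ this, Kernel.fst_apply]
    rfl
  -- The laws of X given η(X) = u average to the law of X.
  have hmass : ∫ u, ∫ x, labelEntropy (μ.condKernel x) ∂κ.fst u ∂ν = condEntropy μ := by
    have hm := measurable_labelEntropy μ.condKernel
    rw [← Measure.integral_compProd (f := fun q : ℝ × 𝒳 => labelEntropy (μ.condKernel q.2))
        (integrable_labelEntropy _ (Kernel.prodMkLeft ℝ μ.condKernel)),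
      compProd_condJoint_fst μ hη, integral_map
        (f := fun q : ℝ × 𝒳 => labelEntropy (μ.condKernel q.2)) (by fun_prop)
        (hm.comp measurable_snd).aestronglyMeasurable, condEntropy, Measure.fst,
      integral_map (by fun_prop) hm.aestronglyMeasurable]
  have hi : Integrable (fun u => labelEntropy (κ.snd u)) ν := integrable_labelEntropy _ _
  have hi' : Integrable (fun u => condEntropy (κ u)) ν := by
    refine (hi.sub (integrable_mutualInfo_condJoint μ η)).congr (ae_of_all _ fun u => ?_)
    simp only [Pi.sub_apply, mutualInfo, Kernel.snd_apply, ← hκ, Measure.snd, sub_sub_cancel]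
  calc condMutualInfo μ η
      = ∫ u, (labelEntropy (κ.snd u) - condEntropy (κ u)) ∂ν := by
        simp only [Kernel.snd_apply]; rfl
    _ = _ := by rw [integral_sub hi hi', integral_congr_ae hcond, hmass, hY]

end ChainRule

/-! ### Auxiliary entropy and conditional expectation bounds. -/

theorem encodedInfo_eq {𝒳 : Type*} [MeasurableSpace 𝒳] {M : ℕ} [NeZero M]
    (μ : Measure (𝒳 × Fin M)) [IsFiniteMeasure μ] {η : 𝒳 → ℝ} (hη : Measurable η) :
    encodedInfo μ η =
      labelEntropy μ.snd - condEntropy (μ.map (fun p => (η p.1, p.2))) := by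
  have : (μ.map (fun p : 𝒳 × Fin M => (η p.1, p.2))).snd = μ.snd :=
    Measure.snd_map_prodMk (by fun_prop)
  rw [encodedInfo, mutualInfo, this]

/-- A measure carried by a finite set has finite entropy. -/
theorem shannonEntropy_ne_top_of_finite {ν : Measure ℝ} {S : Set ℝ} (hS : S.Finite)
    (h : ν Sᶜ = 0) : shannonEntropy ν ≠ ∞ := by
  rw [shannonEntropy, if_pos ⟨S, hS.countable, h⟩, tsum_eq_sum (s := hS.toFinset)]
  · exact (ENNReal.sum_lt_top.2 fun _ _ => ENNReal.ofReal_lt_top).ne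
  · intro u hu
    have : ν.real {u} = 0 := by
      rw [measureReal_def, measure_mono_null (t := Sᶜ) (by simpa using hu) h, ENNReal.toReal_zero]
    simp [this]

/-- A function uniformly close to an `m`-measurable one is close to its conditional expectation
given `m`. -/
theorem ae_abs_sub_condExp_le {Ω : Type*} {m m₀ : MeasurableSpace Ω} {μ : Measure Ω}
    [IsFiniteMeasure μ] (hm : m ≤ m₀) {f g : Ω → ℝ} (hf : Integrable f μ)
    (hg : StronglyMeasurable[m] g) (hgi : Integrable g μ) {δ : ℝ} (h : ∀ ω, |f ω - g ω| ≤ δ) :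
    ∀ᵐ ω ∂μ, |f ω - (μ[f | m]) ω| ≤ 2 * δ := by
  have hδ : StronglyMeasurable[m] fun _ : Ω => δ := stronglyMeasurable_const
  -- The functions g ± δ are `m`-measurable, so g - δ ≤ f ≤ g + δ survives conditioning: f and its
  -- conditional expectation both lie within δ of g.
  have hup := condExp_mono (m := m) hf (hgi.add (integrable_const δ))
    (ae_of_all _ fun ω => by
      have := (abs_le.1 (h ω)).2
      simp only [Pi.add_apply]; linarith)
  have hlow := condExp_mono (m := m) (hgi.sub (integrable_const δ)) hf
    (ae_of_all _ fun ω => by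
      have := (abs_le.1 (h ω)).1
      simp only [Pi.sub_apply]; linarith)
  rw [condExp_of_stronglyMeasurable hm (hg.add hδ) (hgi.add (integrable_const δ))] at hup
  rw [condExp_of_stronglyMeasurable hm (hg.sub hδ) (hgi.sub (integrable_const δ))] at hlow
  filter_upwards [hup, hlow] with ω h1 h2
  have h3 := abs_le.1 (h ω)
  simp only [Pi.add_apply, Pi.sub_apply] at h1 h2
  rw [abs_le]
  constructor <;> linarith [h3.1, h3.2]

theorem abs_labelEntropy_sub_le {M : ℕ} {ν ν' : Measure (Fin M)} {τ : ℝ}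
    (h : ∀ y, |Real.negMulLog (ν.real {y}) - Real.negMulLog (ν'.real {y})| ≤ τ) :
    |labelEntropy ν - labelEntropy ν'| ≤ M * τ := by
  unfold labelEntropy
  rw [← Finset.sum_sub_distrib]
  refine (Finset.abs_sum_le_sum_abs _ _).trans ((Finset.sum_le_sum fun y _ => h y).trans ?_)
  simp

/-! ### Rounding the posterior. -/

section Quantization

variable {𝒳 : Type*} [MeasurableSpace 𝒳] {M : ℕ} [NeZero M]
  (μ : Measure (𝒳 × Fin M)) [IsProbabilityMeasure μ] {η : 𝒳 → ℝ}

/-- Expresses posteriors given X (`f = id`) and given η(X) as conditional expectations on one space,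
where the tower property applies. -/
theorem condKernel_map_ae_eq_condExp {𝒵 : Type*} [MeasurableSpace 𝒵] {f : 𝒳 → 𝒵}
    (hf : Measurable f) (y : Fin M) :
    (fun p : 𝒳 × Fin M =>
      ((μ.map (fun p => (f p.1, p.2))).condKernel (f p.1)).real {y}) =ᵐ[μ]
      μ⟦Prod.snd ⁻¹' {y} | MeasurableSpace.comap (fun p => f p.1) inferInstance⟧ := by
  have h := condDistrib_ae_eq_condExp (μ := μ) (X := fun p => f p.1) (Y := Prod.snd)
    (hf.comp measurable_fst) measurable_snd (MeasurableSet.singleton y)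
  rwa [condDistrib] at h

/-- If `P(Y=y|X)` is uniformly close to a function of `η(X)`, it is close to `P(Y=y|η(X))`. -/
theorem ae_abs_condKernel_map_sub_le (hη : Measurable η) (y : Fin M) {g : ℝ → ℝ}
    (hg : Measurable g) {δ : ℝ}
    (h : ∀ x, |(μ.condKernel x).real {y} - g (η x)| ≤ δ) :
    ∀ᵐ p ∂μ, |(μ.condKernel p.1).real {y} -
      ((μ.map (fun p => (η p.1, p.2))).condKernel (η p.1)).real {y}| ≤ 2 * δ := by
  have hηm : Measurable fun p : 𝒳 × Fin M => η p.1 := hη.comp measurable_fst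
  have hpm : Measurable fun p : 𝒳 × Fin M => (μ.condKernel p.1).real {y} :=
    ((μ.condKernel.measurable_coe (MeasurableSet.singleton y)).comp measurable_fst).ennreal_toReal
  have hpi : Integrable (fun p : 𝒳 × Fin M => (μ.condKernel p.1).real {y}) μ :=
    Integrable.of_bound hpm.aestronglyMeasurable 1 (ae_of_all _ fun p => by
      rw [Real.norm_eq_abs, abs_of_nonneg measureReal_nonneg]; exact measureReal_le_one)
  have hgi : Integrable (fun p : 𝒳 × Fin M => g (η p.1)) μ := by
    refine Integrable.of_bound (hg.comp hηm).aestronglyMeasurable (1 + δ)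
      (ae_of_all _ fun p => ?_)
    have h1 := abs_le.1 (h p.1)
    have h2 : 0 ≤ (μ.condKernel p.1).real {y} := measureReal_nonneg
    have h3 : (μ.condKernel p.1).real {y} ≤ 1 := measureReal_le_one
    rw [Real.norm_eq_abs, abs_le]
    constructor <;> linarith [h1.1, h1.2]
  have hX : (fun p : 𝒳 × Fin M => (μ.condKernel p.1).real {y}) =ᵐ[μ]
      μ⟦Prod.snd ⁻¹' {y} | MeasurableSpace.comap (fun p => p.1) inferInstance⟧ := by
    have := condKernel_map_ae_eq_condExp μ measurable_id y
    simpa only [id, Prod.mk.eta, Measure.map_id'] using this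
  have hle : MeasurableSpace.comap (fun p : 𝒳 × Fin M => η p.1) inferInstance ≤
      MeasurableSpace.comap (fun p : 𝒳 × Fin M => p.1) inferInstance := by
    rintro _ ⟨s, hs, rfl⟩
    exact ⟨η ⁻¹' s, hη hs, rfl⟩
  -- Tower property: P(Y=y|η(X)) = E[P(Y=y|X) | η(X)].
  have hU := (condKernel_map_ae_eq_condExp μ hη y).trans <|
    (condExp_condExp_of_le hle measurable_fst.comap_le).symm.trans (condExp_congr_ae hX.symm)
  filter_upwards [hU, ae_abs_sub_condExp_le hηm.comap_le hpi
    (hg.comp (comap_measurable _)).stronglyMeasurable hgi fun p => h p.1] with p hp hp'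
  rwa [hp]

theorem condEntropy_map_sub_le (hη : Measurable η) {c : ℝ}
    (h : ∀ᵐ p ∂μ, |labelEntropy (μ.condKernel p.1) -
      labelEntropy ((μ.map (fun p => (η p.1, p.2))).condKernel (η p.1))| ≤ c) :
    condEntropy (μ.map (fun p => (η p.1, p.2))) - condEntropy μ ≤ c := by
  have hprob : IsProbabilityMeasure (μ.map (fun p => (η p.1, p.2))) :=
    Measure.isProbabilityMeasure_map (by fun_prop)
  set κ := (μ.map (fun p => (η p.1, p.2))).condKernel with hκ
  have h1 : condEntropy (μ.map (fun p => (η p.1, p.2))) =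
      ∫ p, labelEntropy (κ (η p.1)) ∂μ := by
    rw [condEntropy, Measure.fst_map_prodMk measurable_snd,
      integral_map (by fun_prop) (measurable_labelEntropy _).aestronglyMeasurable]
  have h2 : condEntropy μ = ∫ p, labelEntropy (μ.condKernel p.1) ∂μ := by
    rw [condEntropy, Measure.fst,
      integral_map (by fun_prop) (measurable_labelEntropy _).aestronglyMeasurable]
  have hi1 : Integrable (fun p : 𝒳 × Fin M => labelEntropy (κ (η p.1))) μ :=
    integrable_labelEntropy μ (κ.comap (fun p : 𝒳 × Fin M => η p.1) (by fun_prop))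
  have hi2 : Integrable (fun p : 𝒳 × Fin M => labelEntropy (μ.condKernel p.1)) μ :=
    integrable_labelEntropy μ (μ.condKernel.comap Prod.fst measurable_fst)
  rw [h1, h2, ← integral_sub hi1 hi2]
  calc ∫ p, (labelEntropy (κ (η p.1)) - labelEntropy (μ.condKernel p.1)) ∂μ
      ≤ ∫ _p, c ∂μ := by
        refine integral_mono_ae (hi1.sub hi2) (integrable_const c) ?_
        filter_upwards [h] with p hp
        linarith [(abs_le.1 hp).1]
    _ = c := by simp

/-- Rounding the posterior `x ↦ (P(Y=y|X=x))_y` gives a finite-valued encoder from which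
every posterior probability can be recovered up to a prescribed error. -/
theorem exists_finite_range_encoder {δ : ℝ} (hδ : 0 < δ) :
    ∃ (η : 𝒳 → ℝ) (g : Fin M → ℝ → ℝ), Measurable η ∧ (Set.range η).Finite ∧
      (∀ y, Measurable (g y)) ∧ ∀ y x, |(μ.condKernel x).real {y} - g y (η x)| ≤ δ := by
  obtain ⟨n, hn⟩ := exists_nat_one_div_lt hδ
  set N : ℝ := n + 1 with hN
  have hNpos : 0 < N := by positivity
  set r : 𝒳 → Fin M → ℕ := fun x y => ⌊N * (μ.condKernel x).real {y}⌋₊ with hr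
  -- A posterior equal to 1 has level n + 1, so n + 2 levels are needed; with them `Fin.ofNat` never
  -- wraps around.
  set q : 𝒳 → Fin M → Fin (n + 2) := fun x y => Fin.ofNat (n + 2) (r x y) with hq
  have hqr : ∀ x y, ((q x y : ℕ) : ℝ) = r x y := by
    intro x y
    have hle : r x y ≤ n + 1 := by
      refine Nat.floor_le_of_le ?_
      push_cast
      exact mul_le_of_le_one_right hNpos.le measureReal_le_one
    have : (q x y : ℕ) = r x y := Nat.mod_eq_of_lt (by omega)
    rw [this]
  have hqm : Measurable q := by
    refine measurable_pi_lambda _ fun y => ?_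
    have hp : Measurable fun x => (μ.condKernel x).real {y} :=
      (μ.condKernel.measurable_coe (MeasurableSet.singleton y)).ennreal_toReal
    exact (measurable_from_nat (f := Fin.ofNat (n + 2))).comp
      (Nat.measurable_floor.comp (hp.const_mul N))
  -- Numbering the grid points by naturals makes the encoder real-valued; it is decoded by `⌊u⌋₊`
  -- and a left inverse of `e`.
  set e : (Fin M → Fin (n + 2)) → ℕ := Encodable.encode with he
  refine ⟨fun x => (e (q x) : ℝ),
    fun y u => ((Function.invFun e ⌊u⌋₊ y : ℕ) : ℝ) / N, ?_, ?_, ?_, ?_⟩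
  · exact (measurable_of_countable fun a => (e a : ℝ)).comp hqm
  · exact (Set.finite_range fun a => (e a : ℝ)).subset
      (Set.range_comp_subset_range q fun a => (e a : ℝ))
  · intro y
    exact (measurable_from_nat (f := fun k => ((Function.invFun e k y : ℕ) : ℝ) / N)).comp
      Nat.measurable_floor
  · intro y x
    simp only [Nat.floor_natCast,
      Function.leftInverse_invFun (Encodable.encode_injective) (q x), he]
    rw [hqr]
    have h0 : 0 ≤ N * (μ.condKernel x).real {y} := mul_nonneg hNpos.le measureReal_nonneg
    have h1 : (r x y : ℝ) ≤ N * (μ.condKernel x).real {y} := Nat.floor_le h0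
    have h2 : N * (μ.condKernel x).real {y} < r x y + 1 := Nat.lt_floor_add_one _
    have h3 : (μ.condKernel x).real {y} - r x y / N =
        (N * (μ.condKernel x).real {y} - r x y) / N := by field_simp
    rw [h3, abs_of_nonneg (div_nonneg (by linarith) hNpos.le)]
    exact (div_le_div_of_nonneg_right (by linarith) hNpos.le).trans hn.le

/-- Some finite-valued encoder loses arbitrarily little information about `Y`. -/
theorem exists_finite_range_condEntropy_lt {ε : ℝ} (hε : 0 < ε) :
    ∃ η : 𝒳 → ℝ, Measurable η ∧ (Set.range η).Finite ∧
      condEntropy (μ.map (fun p => (η p.1, p.2))) - condEntropy μ < ε := by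
  have hM : (0 : ℝ) < M := Nat.cast_pos.2 (NeZero.pos M)
  have huc : UniformContinuousOn Real.negMulLog (Set.Icc 0 1) :=
    isCompact_Icc.uniformContinuousOn_of_continuous Real.continuous_negMulLog.continuousOn
  -- Summed over M labels, ε / (2 * M) gives ε / 2. Below, rounding to δ / 4 gives posteriors within
  -- δ / 2, hence strictly within δ.
  obtain ⟨δ, hδ, hδε⟩ := Metric.uniformContinuousOn_iff.1 huc (ε / (2 * M)) (by positivity)
  obtain ⟨η, g, hη, hfin, hg, h⟩ := exists_finite_range_encoder μ (δ := δ / 4) (by positivity)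
  refine ⟨η, hη, hfin, ?_⟩
  have hprob : IsProbabilityMeasure (μ.map (fun p => (η p.1, p.2))) :=
    Measure.isProbabilityMeasure_map (by fun_prop)
  refine (condEntropy_map_sub_le μ hη (c := M * (ε / (2 * M))) ?_).trans_lt ?_
  · filter_upwards [ae_all_iff.2 fun y => ae_abs_condKernel_map_sub_le μ hη y (hg y) (h y)]
      with p hp
    refine abs_labelEntropy_sub_le fun y => ?_
    refine (hδε _ ⟨measureReal_nonneg, measureReal_le_one⟩ _
      ⟨measureReal_nonneg, measureReal_le_one⟩ ?_).le
    rw [Real.dist_eq]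
    exact (hp y).trans_lt (by linarith)
  · field_simp
    linarith

end Quantization

/-! ### Comparison of a solution with the finite-valued encoder. -/

theorem exists_forall_condMutualInfo_lt {𝒳 : Type*} [MeasurableSpace 𝒳] [StandardBorelSpace 𝒳]
    [Nonempty 𝒳] {M : ℕ} [NeZero M] (μ : Measure (𝒳 × Fin M)) [IsProbabilityMeasure μ]
    {ε : ℝ} (hε : 0 < ε) :
    ∃ B₀ : ℝ, 0 < B₀ ∧ ∀ B : ℝ, B₀ ≤ B → ∀ η : 𝒳 → ℝ, IsIBSolution μ B η →
      condMutualInfo μ η < ε := by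
  obtain ⟨η', hη', hfin, hlt⟩ := exists_finite_range_condEntropy_lt μ hε
  have hne : shannonEntropy (μ.fst.map η') ≠ ∞ := by
    refine shannonEntropy_ne_top_of_finite hfin ?_
    rw [Measure.map_apply hη' hfin.measurableSet.compl]
    simp [Set.preimage_compl]
  -- The added 1 keeps the threshold positive when the entropy is zero.
  refine ⟨(shannonEntropy (μ.fst.map η')).toReal + 1, by positivity, fun B hB η hη => ?_⟩
  have hmax := hη.isMax η' hη' (ENNReal.le_ofReal_iff_toReal_le hne
    ((by positivity : (0 : ℝ) ≤ _).trans hB) |>.2 (by linarith))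
  -- H(Y) cancels, so optimality reads H(Y|η(X)) ≤ H(Y|η'(X)).
  rw [encodedInfo_eq μ hη', encodedInfo_eq μ hη.measurable] at hmax
  rw [condMutualInfo_eq_sub μ hη.measurable]
  linarith

theorem lemma5 {d M : ℕ} [NeZero M] (μ : Measure (EuclideanSpace ℝ (Fin d) × Fin M))
    [IsProbabilityMeasure μ] :
    (∀ ε : ℝ, 0 < ε → ∃ B₀ : ℝ, 0 < B₀ ∧ ∀ B : ℝ, B₀ ≤ B →
      ∀ η : EuclideanSpace ℝ (Fin d) → ℝ, IsIBSolution μ B η → condMutualInfo μ η < ε) ∧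
    (∀ η : ℝ → EuclideanSpace ℝ (Fin d) → ℝ, (∀ B : ℝ, 0 < B → IsIBSolution μ B (η B)) →
      Tendsto (fun B => condMutualInfo μ (η B)) atTop (𝓝 0)) := by
  refine ⟨fun ε hε => exists_forall_condMutualInfo_lt μ hε, fun η hη => ?_⟩
  refine Metric.tendsto_atTop.2 fun ε hε => ?_
  obtain ⟨B₀, hB₀, h⟩ := exists_forall_condMutualInfo_lt μ hε
  refine ⟨B₀, fun B hB => ?_⟩
  rw [Real.dist_0_eq_abs, abs_of_nonneg (condMutualInfo_nonneg μ _)]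
  exact h B hB (η B) (hη B (hB₀.trans_le hB))
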